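/- Let $(G_n)$ be a sequence of finite simple graphs and let $(c_n)$ be a sequence of positive integers with $c_n\to\infty$. Color the vertices of $G_n$ independently and uniformly at random with $c_n$ colors, and let $X_v$ denote the color of the vertex $v$. For a finite simple graph $F$ let $N(F,G_n)$ be the number of copies of $F$ in $G_n$, i.e. the number of (not necessarily induced) subgraphs of $G_n$ isomorphic to $F$. For an integer $s\ge 2$ let $K_s$ be the complete graph on $s$ vertices and let $T(K_s,G_n)$ be the number of monochromatic copies of $K_s$ in $G_n$, $$T(K_s,G_n)=\frac1{|\mathrm{Aut}(K_s)|}\sum_{(v_1,\dots,v_s)}\ \prod_{1\le i<j\le s}\mathbf 1\{v_iv_j\in E(G_n)\}\ \mathbf 1\{X_{v_1}=\dots=X_{v_s}\},$$ where the sum is over all $s$-tuples of distinct vertices of $G_n$. For $2\le t\le s-1$ let $J_t(K_s)$ be the $t$-join of two $s$-cliques: the union of two copies of $K_s$ whose vertex sets have exactly $t$ vertices in common. Let $\lambda\ge 0$. (a) If $\mathbb E\,T(K_s,G_n)\to\lambda$ and, for every integer $t$ with $2\le t\le s-1$, $$N(J_t(K_s),G_n)=o\big(c_n^{2s-t-1}\big)\qquad(n\to\infty),$$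 then $T(K_s,G_n)$ converges in distribution to $\mathrm{Poisson}(\lambda)$ (the point mass at $0$ if $\lambda=0$). The same conclusion holds if $\mathbb E\,T(K_s,G_n)\to\lambda$ and, for every integer $t$ with $2\le t\le s-1$, $N(J_t(K_s),G_n)=o\big(N(K_s,G_n)^{\frac{2s-t-1}{s-1}}\big)$. (b) In particular, for triangles: if $\mathbb E\,T(K_3,G_n)\to\lambda$ and $N(\mathcal D,G_n)=o\big(N(K_3,G_n)^{3/2}\big)$, where $\mathcal D$ is the diamond (the 4-cycle with a diagonal), then $T(K_3,G_n)$ converges in distribution to $\mathrm{Poisson}(\lambda)$. -/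

import Mathlib

open Filter MeasureTheory ProbabilityTheory Asymptotics
open scoped NNReal ENNReal Topology

namespace MonoClique

/-- `X v` is the random color of the vertex `v`: the colors of the vertices are independent and each
is uniform on the `k` colors. -/
structure IsUniformColoring {Ω V : Type*} [MeasurableSpace Ω] {k : ℕ}
    (X : V → Ω → Fin k) (P : Measure Ω) : Prop where
  measurable : ∀ v, Measurable (X v)
  uniform : ∀ v a, P {ω | X v ω = a} = (k : ℝ≥0∞)⁻¹
  indep : iIndepFun X P

open Classical in
/-- The number `T(H, G)` of monochromatic copies of `H` in `G` under the vertex coloring `x`: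
`1 / |Aut H|` times the sum, over the tuples `s` of distinct vertices of `G` indexed by the vertices
of `H`, of the product over the edges `ab` of `H` of the adjacency indicators of `s a` and `s b`,
times the indicator that all the entries of `s` have the same color. -/
noncomputable def monoCount {W V C : Type*} [Fintype W] [Fintype V]
    (H : SimpleGraph W) (G : SimpleGraph V) (x : V → C) : ℝ :=
  (1 / (Nat.card (H ≃g H) : ℝ)) *
    ∑ s : W ↪ V, (∏ e ∈ H.edgeFinset, if e.map s ∈ G.edgeSet then (1 : ℝ) else 0) *
      (if ∀ a b : W, x (s a) = x (s b) then (1 : ℝ) else 0)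

/-- The complete graph on `s` vertices. -/
abbrev clique (s : ℕ) : SimpleGraph (Fin s) := ⊤

/-- The `t`-join of two `s`-cliques (for `t ≤ s`): the union of the complete graph on the vertices
`0, …, s - 1` and the complete graph on the vertices `s - t, …, 2 s - t - 1`. These two sets of `s`
vertices have exactly `t` vertices in common. -/
def cliqueJoin (s t : ℕ) : SimpleGraph (Fin (2 * s - t)) where
  Adj i j := i ≠ j ∧ ((i.val < s ∧ j.val < s) ∨ (s - t ≤ i.val ∧ s - t ≤ j.val))
  symm := ⟨fun _ _ h => ⟨h.1.symm, h.2.imp And.symm And.symm⟩⟩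
  loopless := ⟨fun _ h => h.1 rfl⟩

/-- The diamond: the 4-cycle with a diagonal. -/
def diamond : SimpleGraph (Fin 4) := SimpleGraph.cycleGraph 4 ⊔ SimpleGraph.edge 0 2

end MonoClique

/-! Let `S` be the family of vertex sets of `s`-cliques, `k` the number of colors, `W` the number of
monochromatic members of `S`, and `a = #S / k ^ (s - 1)` its mean. The Poisson law is characterized
by `(j + 1) P(W = j + 1) = a P(W = j)`, and the proof shows that this holds up to a vanishing error
(`abs_stein_le`).

Giving all of `K` the color of one vertex `u ∈ K` turns a uniform coloring into one conditioned on
`K` being monochromatic (`card_recolor`). Hence `k ^ (s - 1) (j + 1) P(W = j + 1)` is the sum over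
`K ∈ S` of the probability that `W = j + 1` after recoloring `K`. Recoloring normally raises `W` by
exactly one. It can fail to do so only if `K` was already monochromatic, or if some other `K'` that
meets `K \ {u}` is monochromatic before or after. Members `K'` sharing `t ≥ 2` vertices with `K`
cost in total about the number of such pairs over `k ^ (2 * s - t - 1)`, which the hypothesis on
joins controls.

Members sharing one vertex are not covered by the hypothesis. As `u` keeps its color, only those
meeting `K` in some `v ≠ u` matter. Taking `u` of maximal degree in `K` gives `deg v ≤ √(deg v * deg
u)`, and Cauchy–Schwarz against the codegrees bounds their number by the pairs sharing at least two
vertices (`sum_sum_erase_setDegree_le`). This is why no condition on one-vertex joins is needed.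

The approximate recursion determines the limiting point probabilities up to the value at `0`, and
Markov's inequality prevents loss of mass (`tendsto_poisson_of_stein`). On the graph side, pairs of
cliques are counted by copies of the join up to a constant (`pairCount_cliqueSets_le`), and `N(K_s)
= O(c ^ (s - 1))` reduces the second condition to the first. -/

namespace MonoClique

/-! ### Recoloring a set, and its effect on the number of monochromatic members -/

section Counting
open Finset
open scoped Classical in
/-- The coloring `x` modified by giving all vertices of `K` the color of `u`. -/
noncomputable def recolor {V C : Type*} (K : Finset V) (u : V) (x : V → C) : V → C :=
  fun v => if v ∈ K then x u else x v

/-- All vertices of `K` have the same color. -/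
def IsMono {V C : Type*} (x : V → C) (K : Finset V) : Prop := ∀ a ∈ K, ∀ b ∈ K, x a = x b

open scoped Classical in
/-- The number of monochromatic members of the family `S`. -/
noncomputable def monoCard {V C : Type*} (S : Finset (Finset V)) (x : V → C) : ℕ :=
  #{K ∈ S | IsMono x K}

variable {V C : Type*} [Fintype V] [Fintype C]

open scoped Classical in
lemma card_agree_off (A : Finset V) (y : V → C) :
    #{x : V → C | ∀ v ∉ A, x v = y v} = Fintype.card C ^ #A := by
  have : ({x : V → C | ∀ v ∉ A, x v = y v} : Finset (V → C)) =
      Fintype.piFinset (fun v => if v ∈ A then univ else {y v}) := by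
    ext x
    simp only [mem_filter, mem_univ, true_and, Fintype.mem_piFinset]
    refine forall_congr' fun v => ?_
    split_ifs with h <;> simp [h]
  rw [this, Fintype.card_piFinset]
  simp only [apply_ite card, card_univ, card_singleton]
  rw [prod_ite]
  simp

open scoped Classical in
-- Recoloring maps onto the colorings that are constant on `K`, and the fiber over such a `y`
-- consists of the colorings that agree with `y` off `K \ {u}`. So a recolored uniform coloring is a
-- uniform coloring conditioned on `K` being monochromatic.
lemma card_recolor (K : Finset V) (u : V) (hu : u ∈ K) (Q : (V → C) → Prop) :
    #{x : V → C | Q (recolor K u x)} =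
      Fintype.card C ^ (#K - 1) * #{x : V → C | IsMono x K ∧ Q x} := by
  rw [card_eq_sum_card_fiberwise (f := recolor K u) (t := {x : V → C | IsMono x K ∧ Q x})]
  · rw [sum_const_nat (m := Fintype.card C ^ (#K - 1)), mul_comm]
    intro y hy
    simp only [mem_filter, mem_univ, true_and] at hy
    rw [← card_erase_of_mem hu, ← card_agree_off _ y]
    congr 1
    ext x
    simp only [mem_filter, mem_univ, true_and]
    constructor
    · rintro ⟨-, rfl⟩ v hv
      simp only [recolor]
      split_ifs with h
      · have : v = u := by simpa [h] using hv
        rw [this]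
      · rfl
    · intro h
      have : recolor K u x = y := by
        ext v
        simp only [recolor]
        split_ifs with hv
        · rw [h u (by simp)]; exact hy.1 _ hu _ hv
        · exact h v (by simp [hv])
      exact ⟨this ▸ hy.2, this⟩
  · intro x hx
    simp only [coe_filter, mem_univ, true_and, Set.mem_ofPred_eq] at hx ⊢
    refine ⟨fun a ha b hb => ?_, hx⟩
    simp [recolor, ha, hb]

open scoped Classical in
lemma card_eq_color (A : Finset V) (u : V) (hu : u ∉ A) :
    Fintype.card C ^ #A * #{x : V → C | ∀ v ∈ A, x v = x u} =
      Fintype.card C ^ Fintype.card V := by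
  have h := card_recolor (C := C) (insert u A) u (mem_insert_self _ _) (fun _ => True)
  rw [card_insert_of_notMem hu] at h
  simp only [filter_true, card_univ, Fintype.card_fun, and_true, Nat.add_sub_cancel] at h
  rw [h]
  congr 2
  ext x
  simp only [mem_filter, mem_univ, true_and]
  simp only [IsMono]
  constructor
  · intro h a ha b hb
    have key : ∀ a ∈ insert u A, x a = x u := by
      intro a ha
      rcases mem_insert.1 ha with rfl | ha
      · rfl
      · exact h a ha
    rw [key a ha, key b hb]
  · intro h v hv
    exact h v (mem_insert_of_mem hv) u (mem_insert_self _ _)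

open scoped Classical in
lemma card_isMono (K : Finset V) (u : V) (hu : u ∈ K) :
    Fintype.card C ^ (#K - 1) * #{x : V → C | IsMono x K} =
      Fintype.card C ^ Fintype.card V := by
  have h := card_recolor (C := C) K u hu (fun _ => True)
  simp only [filter_true, card_univ, Fintype.card_fun, and_true] at h
  rw [h]

open scoped Classical in
-- After recoloring, `K ∩ K'` carries the color of `u` and is nonempty because of `w`. Only the
-- vertices of `K' \ K` remain to be matched to that color.
lemma card_isMono_recolor (K K' : Finset V) (u w : V) (hu : u ∈ K) (hw : w ∈ K) (hw' : w ∈ K') :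
    Fintype.card C ^ #(K' \ K) * #{x : V → C | IsMono (recolor K u x) K'} =
      Fintype.card C ^ Fintype.card V := by
  rw [← card_eq_color (C := C) (K' \ K) u (by simp [hu])]
  congr 2
  ext x
  simp only [mem_filter, mem_univ, true_and]
  simp only [IsMono, Finset.mem_sdiff]
  constructor
  · rintro h v ⟨hv, hvK⟩
    simpa [recolor, hvK, hw] using h v hv w hw'
  · intro h
    have key : ∀ a ∈ K', recolor K u x a = x u := by
      intro a ha
      simp only [recolor]
      split_ifs with haK
      · rfl
      · exact h a ⟨ha, haK⟩
    intro a ha b hb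
    rw [key a ha, key b hb]

omit [Fintype V] [Fintype C] in
/-- `recolor` does not affect the sets which meet `K` at most in `u`. -/
lemma isMono_recolor_iff [DecidableEq V] (K K' : Finset V) (u : V)
    (h : Disjoint K' (K.erase u)) (x : V → C) : IsMono (recolor K u x) K' ↔ IsMono x K' := by
  have key : ∀ a ∈ K', recolor K u x a = x a := by
    intro a ha
    simp only [recolor]
    split_ifs with haK
    · by_cases hau : a = u
      · rw [hau]
      · exact absurd (mem_erase.2 ⟨hau, haK⟩) (disjoint_left.1 h ha)
    · rfl
  refine forall₂_congr fun a ha => forall₂_congr fun b hb => ?_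
  rw [key a ha, key b hb]

omit [Fintype V] [Fintype C] in
open scoped Classical in
lemma monoCard_recolor_eq (S : Finset (Finset V)) (K : Finset V) (hK : K ∈ S) (u : V) (hu : u ∈ K)
    (x : V → C) (hx : ¬ IsMono x K)
    (h : ∀ K' ∈ S, K' ≠ K → ¬ Disjoint K' (K.erase u) →
      ¬ IsMono x K' ∧ ¬ IsMono (recolor K u x) K') :
    monoCard S (recolor K u x) = monoCard S x + 1 := by
  have : ({K' ∈ S | IsMono (recolor K u x) K'} : Finset (Finset V)) =
      insert K {K' ∈ S | IsMono x K'} := by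
    ext K'
    simp only [mem_filter, mem_insert]
    by_cases hKK : K' = K
    · subst hKK
      simp only [hK, true_and, true_or, iff_true]
      intro a ha b hb
      simp [recolor, ha, hb]
    · simp only [hKK, false_or]
      refine and_congr_right fun hS => ?_
      by_cases hd : Disjoint K' (K.erase u)
      · exact isMono_recolor_iff K K' u hd x
      · have := h K' hS hKK hd
        tauto
  rw [monoCard, this, card_insert_of_notMem (by simp [hx]), monoCard]

open scoped Classical in
-- Double counting of pairs of a coloring with value `j` and a monochromatic member.
lemma sum_card_isMono (S : Finset (Finset V)) (j : ℕ) :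
    ∑ K ∈ S, #{x : V → C | IsMono x K ∧ monoCard S x = j} =
      j * #{x : V → C | monoCard S x = j} := by
  have h1 : ∀ K ∈ S, #{x : V → C | IsMono x K ∧ monoCard S x = j} =
      #{x ∈ ({x : V → C | monoCard S x = j} : Finset _) | IsMono x K} := by
    intro K _
    rw [filter_filter]
    simp only [and_comm]
  rw [sum_congr rfl h1]
  have h2 := sum_card_bipartiteAbove_eq_sum_card_bipartiteBelow (s := S)
    (t := ({x : V → C | monoCard S x = j} : Finset _)) (fun K x => IsMono x K)
  simp only [bipartiteAbove, bipartiteBelow] at h2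
  rw [h2, sum_const_nat (m := j), mul_comm]
  intro x hx
  simp only [mem_filter, mem_univ, true_and] at hx
  exact hx

open scoped Classical in
/-- The comparison of `monoCard` before and after recoloring `K`. -/
lemma abs_card_recolor_sub_le (S : Finset (Finset V)) (K : Finset V) (hK : K ∈ S) (u : V)
    (hu : u ∈ K) (j : ℕ) :
    |(#{x : V → C | monoCard S (recolor K u x) = j + 1} : ℝ) - #{x : V → C | monoCard S x = j}| ≤
      #{x : V → C | IsMono x K} + ∑ K' ∈ S with K' ≠ K ∧ ¬ Disjoint K' (K.erase u),
        ((#{x : V → C | IsMono x K'} : ℝ) + #{x : V → C | IsMono (recolor K u x) K'}) := by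
  -- The bad colorings. Off `B` recoloring raises the count by exactly one, so the two events differ
  -- only inside `B`.
  set B : Finset (V → C) := ({x : V → C | IsMono x K} : Finset _) ∪
    ({K' ∈ S | K' ≠ K ∧ ¬ Disjoint K' (K.erase u)} : Finset _).biUnion fun K' =>
      ({x : V → C | IsMono x K'} : Finset _) ∪ ({x : V → C | IsMono (recolor K u x) K'} : Finset _)
    with hB
  have hBc : (#B : ℝ) ≤ #{x : V → C | IsMono x K} +
      ∑ K' ∈ S with K' ≠ K ∧ ¬ Disjoint K' (K.erase u),
        ((#{x : V → C | IsMono x K'} : ℝ) + #{x : V → C | IsMono (recolor K u x) K'}) := by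
    have : #B ≤ #{x : V → C | IsMono x K} + ∑ K' ∈ S with K' ≠ K ∧ ¬ Disjoint K' (K.erase u),
        (#{x : V → C | IsMono x K'} + #{x : V → C | IsMono (recolor K u x) K'}) := by
      refine (card_union_le _ _).trans (Nat.add_le_add_left ?_ _)
      exact card_biUnion_le.trans (sum_le_sum fun _ _ => card_union_le _ _)
    exact_mod_cast this
  have key : ∀ x ∉ B, monoCard S (recolor K u x) = monoCard S x + 1 := by
    intro x hx
    simp only [hB, mem_union, mem_biUnion, mem_filter, mem_univ, true_and, not_or, not_exists,
      not_and] at hx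
    exact monoCard_recolor_eq S K hK u hu x hx.1 fun K' h1 h2 h3 => hx.2 K' ⟨h1, h2, h3⟩
  refine le_trans (abs_sub_le_iff.2 ⟨?_, ?_⟩) hBc
  · rw [sub_le_iff_le_add']
    have : ({x : V → C | monoCard S (recolor K u x) = j + 1} : Finset _) ⊆
        ({x : V → C | monoCard S x = j} : Finset _) ∪ B := by
      intro x hx
      simp only [mem_filter, mem_univ, true_and, mem_union] at hx ⊢
      by_cases hxB : x ∈ B
      · exact Or.inr hxB
      · have := key x hxB
        left; omega
    exact_mod_cast (card_le_card this).trans (card_union_le _ _)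
  · rw [sub_le_iff_le_add']
    have : ({x : V → C | monoCard S x = j} : Finset _) ⊆
        ({x : V → C | monoCard S (recolor K u x) = j + 1} : Finset _) ∪ B := by
      intro x hx
      simp only [mem_filter, mem_univ, true_and, mem_union] at hx ⊢
      by_cases hxB : x ∈ B
      · exact Or.inr hxB
      · have := key x hxB
        left; omega
    exact_mod_cast (card_le_card this).trans (card_union_le _ _)

end Counting

/-! ### Degrees and codegrees in a family of `s`-sets -/

section Degrees
open Finset
open scoped Classical in
/-- The number of members of `S` which contain `v`. -/
noncomputable def setDegree {V : Type*} (S : Finset (Finset V)) (v : V) : ℕ := #{K ∈ S | v ∈ K}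

open scoped Classical in
/-- The number of ordered pairs of members of `S` which have exactly `t` elements in common. -/
noncomputable def pairCount {V : Type*} (S : Finset (Finset V)) (t : ℕ) : ℕ :=
  #{p ∈ S ×ˢ S | #(p.1 ∩ p.2) = t}

variable {V : Type*}

open scoped Classical in
lemma sum_card_inter_eq (S : Finset (Finset V)) (t : ℕ) :
    ∑ K ∈ S, #{K' ∈ S | #(K ∩ K') = t} = pairCount S t := by
  rw [pairCount, card_filter, sum_product]
  simp_rw [card_filter]

open scoped Classical in
lemma card_pairs_two_le (S : Finset (Finset V)) (s : ℕ) (hS : ∀ K ∈ S, #K = s) :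
    #{p ∈ S ×ˢ S | 2 ≤ #(p.1 ∩ p.2)} ≤ #S + ∑ t ∈ Icc 2 (s - 1), pairCount S t := by
  have : ({p ∈ S ×ˢ S | 2 ≤ #(p.1 ∩ p.2)} : Finset _) ⊆
      S.image (fun K => (K, K)) ∪ (Icc 2 (s - 1)).biUnion fun t =>
        {p ∈ S ×ˢ S | #(p.1 ∩ p.2) = t} := by
    rintro ⟨K, K'⟩ hp
    simp only [mem_filter, mem_product, mem_union, mem_image, mem_biUnion, mem_Icc] at hp ⊢
    obtain ⟨⟨hK, hK'⟩, h2⟩ := hp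
    by_cases h : K = K'
    · exact Or.inl ⟨K, hK, by rw [h]⟩
    · refine Or.inr ⟨_, ⟨h2, ?_⟩, ⟨hK, hK'⟩, rfl⟩
      have h3 : #(K ∩ K') < s := by
        rw [← hS K hK]
        refine card_lt_card ⟨inter_subset_left, fun hsub => h ?_⟩
        exact eq_of_subset_of_card_le (fun a ha => (mem_inter.1 (hsub ha)).2)
          (by rw [hS K hK, hS K' hK'])
      omega
  refine (card_le_card this).trans ((card_union_le _ _).trans ?_)
  exact Nat.add_le_add card_image_le card_biUnion_le

variable [Fintype V]

open scoped Classical in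
lemma sum_setDegree (S : Finset (Finset V)) (s : ℕ) (hS : ∀ K ∈ S, #K = s) :
    ∑ v, setDegree S v = s * #S := by
  have h2 := sum_card_bipartiteAbove_eq_sum_card_bipartiteBelow (s := (univ : Finset V))
    (t := S) (fun v K => v ∈ K)
  simp only [bipartiteAbove, bipartiteBelow] at h2
  simp only [setDegree]
  rw [h2, sum_const_nat (m := s), mul_comm]
  intro K hK
  rw [← hS K hK]
  simp

open scoped Classical in
-- The squared codegree of a pair of vertices counts the pairs of members whose intersection
-- contains both. A pair of members is counted at most `s ^ 2` times, and only if it shares at least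
-- two vertices.
lemma sum_codegree_sq_le (S : Finset (Finset V)) (s : ℕ) (hS : ∀ K ∈ S, #K = s) :
    ∑ p ∈ (univ : Finset V).offDiag, (#{K ∈ S | p.1 ∈ K ∧ p.2 ∈ K} : ℝ) ^ 2 ≤
      s ^ 2 * ((#S : ℝ) + ∑ t ∈ Icc 2 (s - 1), (pairCount S t : ℝ)) := by
  have h1 : ∀ p : V × V, #{K ∈ S | p.1 ∈ K ∧ p.2 ∈ K} ^ 2 =
      #{q ∈ S ×ˢ S | p ∈ (q.1 ∩ q.2) ×ˢ (q.1 ∩ q.2)} := by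
    intro p
    rw [sq, ← card_product, ← filter_product]
    congr 1
    ext q
    simp only [mem_filter, mem_product, mem_inter]
    tauto
  have h2 := sum_card_bipartiteAbove_eq_sum_card_bipartiteBelow
    (s := (univ : Finset V).offDiag) (t := S ×ˢ S)
    (fun p q => p ∈ (q.1 ∩ q.2) ×ˢ (q.1 ∩ q.2))
  simp only [bipartiteAbove, bipartiteBelow] at h2
  have h3 : ∀ q ∈ S ×ˢ S, #{p ∈ (univ : Finset V).offDiag | p ∈ (q.1 ∩ q.2) ×ˢ (q.1 ∩ q.2)} ≤
      if 2 ≤ #(q.1 ∩ q.2) then s ^ 2 else 0 := by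
    intro q hq
    have hle : #(q.1 ∩ q.2) ≤ s := by
      rw [← hS q.1 (mem_product.1 hq).1]; exact card_le_card inter_subset_left
    split_ifs with h
    · rw [sq]
      refine le_trans ?_ (Nat.mul_le_mul hle hle)
      rw [← card_product]
      exact card_le_card fun p hp => (mem_filter.1 hp).2
    · rw [Nat.le_zero, card_eq_zero, filter_eq_empty_iff]
      rintro p hp hpq
      apply h
      rw [mem_product] at hpq
      exact one_lt_card.2 ⟨p.1, hpq.1, p.2, hpq.2, (mem_offDiag.1 hp).2.2⟩
  have h4 : ∑ p ∈ (univ : Finset V).offDiag, #{K ∈ S | p.1 ∈ K ∧ p.2 ∈ K} ^ 2 ≤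
      s ^ 2 * (#S + ∑ t ∈ Icc 2 (s - 1), pairCount S t) := by
    simp_rw [h1]
    rw [h2]
    refine (sum_le_sum h3).trans ?_
    rw [← sum_filter, sum_const, smul_eq_mul, mul_comm]
    exact Nat.mul_le_mul_left _ (card_pairs_two_le S s hS)
  exact_mod_cast h4

open scoped Classical in
/-- If `u K` has maximal degree in `K`, then the sum of the other degrees is small. -/
lemma sum_sum_erase_setDegree_le (S : Finset (Finset V)) (s : ℕ) (hS : ∀ K ∈ S, #K = s)
    (u : Finset V → V) (hu : ∀ K ∈ S, u K ∈ K)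
    (hmax : ∀ K ∈ S, ∀ v ∈ K, setDegree S v ≤ setDegree S (u K)) :
    ∑ K ∈ S, ∑ v ∈ K.erase (u K), (setDegree S v : ℝ) ≤
      s ^ 2 * #S * √((#S : ℝ) + ∑ t ∈ Icc 2 (s - 1), (pairCount S t : ℝ)) := by
  set Q : ℝ := (#S : ℝ) + ∑ t ∈ Icc 2 (s - 1), (pairCount S t : ℝ)
  set f : V × V → ℝ := fun p => √(setDegree S p.1) * √(setDegree S p.2) with hf
  -- By maximality of `u K`, a degree is at most the geometric mean `f (v, u K)`. Enlarging to all
  -- ordered pairs in `K` removes the dependence on `u`.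
  have h1 : ∀ K ∈ S, ∑ v ∈ K.erase (u K), (setDegree S v : ℝ) ≤ ∑ p ∈ K.offDiag, f p := by
    intro K hK
    calc ∑ v ∈ K.erase (u K), (setDegree S v : ℝ)
        ≤ ∑ v ∈ K.erase (u K), f (v, u K) := by
          refine sum_le_sum fun v hv => ?_
          have h := hmax K hK v (mem_of_mem_erase hv)
          have h' : √(setDegree S v : ℝ) ≤ √(setDegree S (u K)) :=
            Real.sqrt_le_sqrt (by exact_mod_cast h)
          calc (setDegree S v : ℝ) = √(setDegree S v) * √(setDegree S v) :=
                (Real.mul_self_sqrt (by positivity)).symm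
            _ ≤ _ := mul_le_mul_of_nonneg_left h' (by positivity)
      _ = ∑ p ∈ (K.erase (u K)).image (fun v => (v, u K)), f p := by
          rw [sum_image]
          intro a _ b _ h
          exact (Prod.ext_iff.1 h).1
      _ ≤ ∑ p ∈ K.offDiag, f p := by
          refine sum_le_sum_of_subset_of_nonneg ?_ fun _ _ _ => by positivity
          intro p hp
          obtain ⟨v, hv, rfl⟩ := mem_image.1 hp
          exact mem_offDiag.2 ⟨mem_of_mem_erase hv, hu K hK, ne_of_mem_erase hv⟩
  -- Exchanging the sums makes the codegree the weight of each pair, ready for Cauchy–Schwarz.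
  have h2 : ∑ K ∈ S, ∑ p ∈ K.offDiag, f p =
      ∑ p ∈ (univ : Finset V).offDiag, (#{K ∈ S | p.1 ∈ K ∧ p.2 ∈ K} : ℝ) * f p := by
    have : ∀ K ∈ S, ∑ p ∈ K.offDiag, f p =
        ∑ p ∈ (univ : Finset V).offDiag, if p.1 ∈ K ∧ p.2 ∈ K then f p else 0 := by
      intro K _
      rw [← sum_filter]
      congr 1
      ext p
      simp only [mem_offDiag, mem_filter, mem_univ, true_and]
      tauto
    rw [sum_congr rfl this, sum_comm]
    refine sum_congr rfl fun p _ => ?_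
    rw [← sum_filter, sum_const, nsmul_eq_mul]
  -- `f p ^ 2` is a product of two degrees, so the sum is at most the square of the sum of all
  -- degrees.
  have h3 : ∑ p ∈ (univ : Finset V).offDiag, f p ^ 2 ≤ ((s : ℝ) * #S) ^ 2 := by
    have hs : (∑ v, (setDegree S v : ℝ)) = s * #S := by exact_mod_cast sum_setDegree S s hS
    rw [← hs, sq, sum_mul_sum, ← sum_product', univ_product_univ]
    refine le_trans (le_of_eq (sum_congr rfl fun p _ => ?_))
      (sum_le_sum_of_subset_of_nonneg (subset_univ _) fun _ _ _ => by positivity)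
    rw [hf]
    simp only [mul_pow]
    rw [Real.sq_sqrt (by positivity), Real.sq_sqrt (by positivity)]
  have hQ : 0 ≤ Q := by positivity
  calc _ ≤ ∑ K ∈ S, ∑ p ∈ K.offDiag, f p := sum_le_sum h1
    _ = _ := h2
    _ ≤ √(∑ p ∈ (univ : Finset V).offDiag, (#{K ∈ S | p.1 ∈ K ∧ p.2 ∈ K} : ℝ) ^ 2) *
        √(∑ p ∈ (univ : Finset V).offDiag, f p ^ 2) := Real.sum_mul_le_sqrt_mul_sqrt _ _ _
    _ ≤ √(s ^ 2 * Q) * √(((s : ℝ) * #S) ^ 2) :=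
        mul_le_mul (Real.sqrt_le_sqrt (sum_codegree_sq_le S s hS)) (Real.sqrt_le_sqrt h3)
          (by positivity) (by positivity)
    _ = _ := by
        rw [Real.sqrt_mul (by positivity), Real.sqrt_sq (by positivity),
          Real.sqrt_sq (by positivity)]
        ring

end Degrees

/-! ### The approximate Stein identity -/

section SteinBound
open Finset
variable {V C : Type*}

open scoped Classical in
-- A member that meets `K` in a single vertex must meet it in some `v ≠ u`, and is charged to the
-- degree of `v`. All others are sorted by the size of the intersection.
lemma sum_recolor_cost_le (S : Finset (Finset V)) (s : ℕ) (hs : 2 ≤ s) (hS : ∀ K ∈ S, #K = s)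
    (u : V) (K : Finset V) (hK : K ∈ S) (g : ℕ → ℝ) (hg : ∀ t, 0 ≤ g t) :
    ∑ K' ∈ S with K' ≠ K ∧ ¬ Disjoint K' (K.erase u), g #(K ∩ K') ≤
      (∑ v ∈ K.erase u, (setDegree S v : ℝ)) * g 1 +
        ∑ t ∈ Icc 2 (s - 1), (#{K' ∈ S | #(K ∩ K') = t} : ℝ) * g t := by
  have hpt : ∀ K' ∈ ({K' ∈ S | K' ≠ K ∧ ¬ Disjoint K' (K.erase u)} : Finset _), g #(K ∩ K') ≤
      (∑ v ∈ K.erase u, if v ∈ K' then g 1 else 0) +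
        ∑ t ∈ Icc 2 (s - 1), if #(K ∩ K') = t then g t else 0 := by
    intro K' h
    obtain ⟨hK', hne, hd⟩ := mem_filter.1 h
    obtain ⟨a, ha, ha'⟩ := not_disjoint_iff.1 hd
    have h1 : 1 ≤ #(K ∩ K') := card_pos.2 ⟨a, mem_inter.2 ⟨mem_of_mem_erase ha', ha⟩⟩
    have h3 : #(K ∩ K') < s := by
      rw [← hS K hK]
      refine card_lt_card ⟨inter_subset_left, fun hsub => hne ?_⟩
      exact (eq_of_subset_of_card_le (fun a ha => (mem_inter.1 (hsub ha)).2)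
        (by rw [hS K hK, hS K' hK'])).symm
    have hn1 : ∀ v ∈ K.erase u, (0 : ℝ) ≤ if v ∈ K' then g 1 else 0 := fun v _ => by
      split_ifs
      exacts [hg 1, le_rfl]
    have hn2 : ∀ t ∈ Icc 2 (s - 1), (0 : ℝ) ≤ if #(K ∩ K') = t then g t else 0 := fun t _ => by
      split_ifs
      exacts [hg t, le_rfl]
    by_cases h2 : #(K ∩ K') = 1
    · refine le_trans ?_ (le_add_of_nonneg_right (sum_nonneg hn2))
      refine le_trans (le_of_eq ?_) (single_le_sum hn1 ha')
      rw [if_pos ha, h2]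
    · refine le_trans ?_ (le_add_of_nonneg_left (sum_nonneg hn1))
      refine le_trans (le_of_eq ?_)
        (single_le_sum hn2 (mem_Icc.2 ⟨by omega, by omega⟩ : #(K ∩ K') ∈ Icc 2 (s - 1)))
      rw [if_pos rfl]
  refine (sum_le_sum hpt).trans ((sum_le_sum_of_subset_of_nonneg (filter_subset _ S)
    fun K' _ _ => add_nonneg (sum_nonneg fun v _ => ?_) (sum_nonneg fun t _ => ?_)).trans
      (le_of_eq ?_))
  · split_ifs
    exacts [hg 1, le_rfl]
  · split_ifs
    exacts [hg t, le_rfl]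
  rw [sum_add_distrib, sum_comm, sum_comm (s := S) (t := Icc 2 (s - 1)), sum_mul]
  simp only [← sum_filter, sum_const, nsmul_eq_mul, setDegree]

/-- The quantity which controls the Poisson approximation of the number of monochromatic members of
a family `S` of `s`-sets, when there are `k` colors. -/
noncomputable def clumping (S : Finset (Finset V)) (s k : ℕ) : ℝ :=
  (#S : ℝ) / (k : ℝ) ^ (2 * (s - 1)) +
    ∑ t ∈ Icc 2 (s - 1), (pairCount S t : ℝ) / (k : ℝ) ^ (2 * s - t - 1)

lemma clumping_nonneg (S : Finset (Finset V)) (s k : ℕ) : 0 ≤ clumping S s k := by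
  unfold clumping
  positivity

/-- Since `2 * s - t - 1 ≤ 2 * (s - 1)` for `t ≥ 1`, the factor `k ^ (2 * (s - 1))` absorbs every
denominator of `clumping`. -/
lemma sqrt_le_sqrt_clumping (S : Finset (Finset V)) (s k : ℕ) (hs : 2 ≤ s) (hk : 1 ≤ k) :
    √((#S : ℝ) + ∑ t ∈ Icc 2 (s - 1), (pairCount S t : ℝ)) ≤
      (k : ℝ) ^ (s - 1) * √(clumping S s k) := by
  have hk' : (1 : ℝ) ≤ k := by exact_mod_cast hk
  have hk0 : (0 : ℝ) < k := by linarith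
  refine Real.sqrt_le_iff.2 ⟨by positivity, ?_⟩
  rw [mul_pow, Real.sq_sqrt (clumping_nonneg S s k), ← pow_mul, mul_comm (s - 1) 2, clumping,
    mul_add, mul_sum, mul_div_cancel₀ _ (by positivity)]
  refine add_le_add le_rfl (sum_le_sum fun t ht => ?_)
  rw [mem_Icc] at ht
  rw [mul_div_left_comm]
  refine le_mul_of_one_le_right (by positivity) ?_
  rw [one_le_div (by positivity)]
  exact pow_le_pow_right₀ hk' (by omega)

variable [Fintype V] [Fintype C]

open scoped Classical in
/-- An approximate form of the Stein identity of the Poisson distribution for the number of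
monochromatic members of a family of `s`-sets. -/
lemma abs_stein_le (S : Finset (Finset V)) (s : ℕ) (hs : 2 ≤ s) (hS : ∀ K ∈ S, #K = s)
    (hC : 1 ≤ Fintype.card C) (j : ℕ) :
    |((j : ℝ) + 1) * ((#{x : V → C | monoCard S x = j + 1} : ℝ) /
        (Fintype.card C : ℝ) ^ Fintype.card V) -
      (#S : ℝ) / (Fintype.card C : ℝ) ^ (s - 1) * ((#{x : V → C | monoCard S x = j} : ℝ) /
        (Fintype.card C : ℝ) ^ Fintype.card V)| ≤
      2 * clumping S s (Fintype.card C) + 2 * s ^ 2 *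
        ((#S : ℝ) / (Fintype.card C : ℝ) ^ (s - 1)) * √(clumping S s (Fintype.card C)) := by
  set k := Fintype.card C with hkdef
  have hk0 : (0 : ℝ) < k := by exact_mod_cast hC
  set T : ℝ := (k : ℝ) ^ Fintype.card V with hT
  have hT0 : 0 < T := by positivity
  set M : ℝ := (k : ℝ) ^ (s - 1) with hM
  have hM0 : 0 < M := by positivity
  rcases S.eq_empty_or_nonempty with rfl | ⟨K₀, hK₀⟩
  · simp [monoCard, clumping, pairCount]
  obtain ⟨v₀, -⟩ : K₀.Nonempty := card_pos.1 (by rw [hS K₀ hK₀]; omega)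
  -- The vertex whose color is kept is one of maximal degree in `K`; `v₀` is a dummy value for sets
  -- outside `S`.
  have hex : ∀ K : Finset V, ∃ v, K ∈ S → v ∈ K ∧ ∀ w ∈ K, setDegree S w ≤ setDegree S v := by
    intro K
    by_cases hK : K ∈ S
    · obtain ⟨v, hv, h⟩ := exists_max_image K (setDegree S) (card_pos.1 (by rw [hS K hK]; omega))
      exact ⟨v, fun _ => ⟨hv, h⟩⟩
    · exact ⟨v₀, fun h => absurd h hK⟩
  choose u hu using hex
  -- Bounds the number of colorings for which a member sharing `t` vertices with `K` is
  -- monochromatic before or after recoloring. The latter is the likelier event, hence the factor 2.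
  set g : ℕ → ℝ := fun t => 2 * T / (k : ℝ) ^ (s - t) with hg
  have hg0 : ∀ t, 0 ≤ g t := fun t => by positivity
  have hmono : ∀ K ∈ S, (#{x : V → C | IsMono x K} : ℝ) = T / M := by
    intro K hK
    have h := card_isMono (C := C) K (u K) (hu K hK).1
    rw [hS K hK] at h
    rw [eq_div_iff hM0.ne', mul_comm, hM, hT, hkdef]
    exact_mod_cast h
  have hcost : ∀ K ∈ S, |(#{x : V → C | monoCard S (recolor K (u K) x) = j + 1} : ℝ) -
      #{x : V → C | monoCard S x = j}| ≤ T / M +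
        ((∑ v ∈ K.erase (u K), (setDegree S v : ℝ)) * g 1 +
        ∑ t ∈ Icc 2 (s - 1), (#{K' ∈ S | #(K ∩ K') = t} : ℝ) * g t) := by
    intro K hK
    refine (abs_card_recolor_sub_le S K hK (u K) (hu K hK).1 j).trans ?_
    rw [hmono K hK]
    refine add_le_add le_rfl (le_trans (sum_le_sum fun K' hK' => ?_)
      (sum_recolor_cost_le S s hs hS (u K) K hK g hg0))
    obtain ⟨hK'S, hne, hd⟩ := mem_filter.1 hK'
    obtain ⟨a, ha, ha'⟩ := not_disjoint_iff.1 hd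
    have haK := mem_of_mem_erase ha'
    have h1 : 1 ≤ #(K ∩ K') := card_pos.2 ⟨a, mem_inter.2 ⟨haK, ha⟩⟩
    have h := card_isMono_recolor (C := C) K K' (u K) a (hu K hK).1 haK ha
    rw [card_sdiff, hS K' hK'S] at h
    have h2 : (#{x : V → C | IsMono (recolor K (u K) x) K'} : ℝ) = T / (k : ℝ) ^ (s - #(K ∩ K')) := by
      rw [eq_div_iff (by positivity), mul_comm, hT, hkdef]
      exact_mod_cast h
    rw [hmono K' hK'S, h2, hg]
    have h3 : T / M ≤ T / (k : ℝ) ^ (s - #(K ∩ K')) :=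
      div_le_div_of_nonneg_left hT0.le (by positivity)
        (pow_le_pow_right₀ (by exact_mod_cast hC) (by omega))
    calc _ ≤ T / (k : ℝ) ^ (s - #(K ∩ K')) + T / (k : ℝ) ^ (s - #(K ∩ K')) :=
          add_le_add h3 le_rfl
      _ = _ := by ring
  -- Double counting writes `(j + 1) #{W = j + 1}` as a sum over `K`, and `card_recolor` uses up the
  -- factor `M` in each term.
  have hmain : M * (((j : ℝ) + 1) * #{x : V → C | monoCard S x = j + 1}) -
      #S * #{x : V → C | monoCard S x = j} =
      ∑ K ∈ S, ((#{x : V → C | monoCard S (recolor K (u K) x) = j + 1} : ℝ) -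
      #{x : V → C | monoCard S x = j}) := by
    rw [sum_sub_distrib, sum_const, nsmul_eq_mul]
    congr 1
    have h := sum_card_isMono (C := C) S (j + 1)
    have h' : ((j : ℝ) + 1) * #{x : V → C | monoCard S x = j + 1} =
        ∑ K ∈ S, (#{x : V → C | IsMono x K ∧ monoCard S x = j + 1} : ℝ) := by
      exact_mod_cast h.symm
    rw [h', mul_sum]
    refine sum_congr rfl fun K hK => ?_
    have h : #{x : V → C | monoCard S (recolor K (u K) x) = j + 1} =
        Fintype.card C ^ (#K - 1) * #{x : V → C | IsMono x K ∧ monoCard S x = j + 1} := by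
      convert card_recolor (C := C) K (u K) (hu K hK).1 (fun x => monoCard S x = j + 1)
    rw [h, hS K hK, hM, hkdef]
    push_cast
    rfl
  have hD := sum_sum_erase_setDegree_le S s hS u (fun K hK => (hu K hK).1)
    (fun K hK => (hu K hK).2)
  have hsq := sqrt_le_sqrt_clumping S s k hs hC
  have hsum : |M * (((j : ℝ) + 1) * #{x : V → C | monoCard S x = j + 1}) -
      #S * #{x : V → C | monoCard S x = j}| ≤ #S * (T / M) +
        ((s ^ 2 * #S * (M * √(clumping S s k))) * g 1 +
          ∑ t ∈ Icc 2 (s - 1), (pairCount S t : ℝ) * g t) := by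
    rw [hmain]
    refine (abs_sum_le_sum_abs _ _).trans ((sum_le_sum hcost).trans ?_)
    rw [sum_add_distrib, sum_const, nsmul_eq_mul, sum_add_distrib, ← sum_mul, sum_comm]
    refine add_le_add le_rfl (add_le_add ?_ (le_of_eq ?_))
    · exact mul_le_mul_of_nonneg_right (hD.trans (mul_le_mul_of_nonneg_left hsq (by positivity)))
        (hg0 1)
    · refine sum_congr rfl fun t _ => ?_
      rw [← sum_mul, ← sum_card_inter_eq]
      push_cast
      rfl
  have hg1 : g 1 = 2 * T / M := rfl
  have hgt : ∀ t ∈ Icc 2 (s - 1), (pairCount S t : ℝ) * g t =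
      2 * (T * M) * ((pairCount S t : ℝ) / (k : ℝ) ^ (2 * s - t - 1)) := by
    intro t ht
    rw [mem_Icc] at ht
    have : (k : ℝ) ^ (2 * s - t - 1) = M * (k : ℝ) ^ (s - t) := by
      rw [hM, ← pow_add]
      congr 1
      omega
    rw [this, hg]
    field_simp
  rw [sum_congr rfl hgt, ← mul_sum, hg1] at hsum
  have hcl : clumping S s k = #S / M ^ 2 +
      ∑ t ∈ Icc 2 (s - 1), (pairCount S t : ℝ) / (k : ℝ) ^ (2 * s - t - 1) := by
    rw [clumping, hM, ← pow_mul, mul_comm 2 (s - 1)]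
  set R := ∑ t ∈ Icc 2 (s - 1), (pairCount S t : ℝ) / (k : ℝ) ^ (2 * s - t - 1)
  have hfac : ((j : ℝ) + 1) * ((#{x : V → C | monoCard S x = j + 1} : ℝ) / T) -
      (#S : ℝ) / M * ((#{x : V → C | monoCard S x = j} : ℝ) / T) =
      (M * (((j : ℝ) + 1) * #{x : V → C | monoCard S x = j + 1}) -
      #S * #{x : V → C | monoCard S x = j}) / (M * T) := by
    field_simp
  rw [hfac, abs_div, abs_of_pos (mul_pos hM0 hT0), div_le_iff₀ (mul_pos hM0 hT0)]
  refine hsum.trans ?_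
  have hc2 : #S * (T / M) + 2 * (T * M) * R ≤ 2 * clumping S s k * (M * T) := by
    rw [hcl]
    have h5 : (#S : ℝ) / M ^ 2 * (M * T) = #S * (T / M) := by field_simp
    have h6 : 0 ≤ (#S : ℝ) * (T / M) := by positivity
    nlinarith
  have h7 : s ^ 2 * #S * (M * √(clumping S s k)) * (2 * T / M) =
      2 * s ^ 2 * ((#S : ℝ) / M) * √(clumping S s k) * (M * T) := by
    field_simp
  linarith

end SteinBound

/-! ### From the Stein recursion to the Poisson limit -/

section Poisson
open Finset

/-- Induction on `k`: boundedness of `p` allows `a n` to be replaced by `l` in the recursion, which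
is then divided by `k + 1`. -/
lemma tendsto_zero_of_stein {p : ℕ → ℕ → ℝ} {a : ℕ → ℝ} {l : ℝ} (ha : Tendsto a atTop (𝓝 l))
    (hp : ∀ n k, |p n k| ≤ 1)
    (h : ∀ k : ℕ, Tendsto (fun n => ((k : ℝ) + 1) * p n (k + 1) - a n * p n k) atTop (𝓝 0))
    (k : ℕ) : Tendsto (fun n => p n k - l ^ k / k.factorial * p n 0) atTop (𝓝 0) := by
  induction k with
  | zero => simp
  | succ k ih =>
    have h1 : Tendsto (fun n => (a n - l) * p n k) atTop (𝓝 0) := by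
      refine Tendsto.zero_mul_isBoundedUnder_le (by simpa using ha.sub_const l) ?_
      exact isBoundedUnder_of ⟨1, fun n => by simpa using hp n k⟩
    have h2 := (((h k).add h1).add (ih.const_mul l)).div_const ((k : ℝ) + 1)
    simp only [mul_zero, add_zero, zero_div] at h2
    refine h2.congr fun n => ?_
    have hk : (k : ℝ) + 1 ≠ 0 := by positivity
    have hf : (k.factorial : ℝ) ≠ 0 := by positivity
    rw [Nat.factorial_succ, pow_succ]
    push_cast
    field_simp
    ring

/-- The recursion gives `p n k ≈ l ^ k / k! * p n 0`. Tightness makes the total mass tend to 1,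
which forces `p n 0 → exp (-l)`. -/
lemma tendsto_poisson_of_stein {p : ℕ → ℕ → ℝ} {a : ℕ → ℝ} {l : ℝ}
    (ha : Tendsto a atTop (𝓝 l)) (hp0 : ∀ n k, 0 ≤ p n k)
    (hp1 : ∀ n K, ∑ k ∈ range K, p n k ≤ 1)
    (htight : ∀ K : ℕ, ∀ᶠ n in atTop, 1 - a n / ((K : ℝ) + 1) ≤ ∑ k ∈ range (K + 1), p n k)
    (h : ∀ k : ℕ, Tendsto (fun n => ((k : ℝ) + 1) * p n (k + 1) - a n * p n k) atTop (𝓝 0))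
    (k : ℕ) :
    Tendsto (fun n => p n k) atTop (𝓝 (Real.exp (-l) * l ^ k / k.factorial)) := by
  have hple : ∀ n k, p n k ≤ 1 := fun n k =>
    (single_le_sum (fun i _ => hp0 n i) (self_mem_range_succ k)).trans (hp1 n (k + 1))
  have hz := tendsto_zero_of_stein ha
    (fun n k => abs_le.2 ⟨by linarith [hp0 n k], hple n k⟩) h
  have hexp : Tendsto (fun K => ∑ k ∈ range K, l ^ k / k.factorial) atTop (𝓝 (Real.exp l)) := by
    rw [Real.exp_eq_exp_ℝ]
    exact (NormedSpace.expSeries_div_hasSum_exp l).tendsto_sum_nat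
  have h0 : Tendsto (fun n => p n 0 * Real.exp l) atTop (𝓝 1) := by
    rw [Metric.tendsto_nhds]
    intro ε hε
    have e1 : ∀ᶠ K : ℕ in atTop, |(∑ k ∈ range (K + 1), l ^ k / k.factorial) - Real.exp l| < ε / 4 :=
      (tendsto_add_atTop_iff_nat 1).2 hexp |>.eventually (Metric.ball_mem_nhds _ (by positivity))
    have e2 : ∀ᶠ K : ℕ in atTop, |(l + 1) / ((K : ℝ) + 1)| < ε / 4 := by
      have : Tendsto (fun K : ℕ => (l + 1) / ((K : ℝ) + 1)) atTop (𝓝 0) :=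
        Tendsto.div_atTop tendsto_const_nhds (tendsto_natCast_atTop_atTop.atTop_add tendsto_const_nhds)
      simpa only [Metric.mem_ball, Real.dist_eq, sub_zero] using
        this.eventually (Metric.ball_mem_nhds _ (by positivity : 0 < ε / 4))
    -- One cutoff `K` makes both the tail of the exponential series and the Markov bound less than
    -- `ε / 4`. The recursion error on the finitely many remaining terms gives a third `ε / 4`.
    obtain ⟨K, hK1, hK2⟩ := (e1.and e2).exists
    have e3 : Tendsto (fun n => ∑ k ∈ range (K + 1), (p n k - l ^ k / k.factorial * p n 0)) atTop
        (𝓝 0) := by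
      simpa using tendsto_finsetSum (range (K + 1)) fun k _ => hz k
    have e4 : ∀ᶠ n in atTop,
        |∑ k ∈ range (K + 1), (p n k - l ^ k / k.factorial * p n 0)| < ε / 4 := by
      simpa using e3.eventually (Metric.ball_mem_nhds _ (by positivity : 0 < ε / 4))
    have e5 : ∀ᶠ n in atTop, a n < l + 1 := ha.eventually_lt_const (by linarith)
    filter_upwards [e4, e5, htight K] with n h4 h5 h6
    rw [Real.dist_eq]
    rw [sum_sub_distrib, ← sum_mul] at h4
    set A := ∑ k ∈ range (K + 1), p n k
    set B := ∑ k ∈ range (K + 1), l ^ k / (k.factorial : ℝ)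
    have hA : A ≤ 1 := hp1 n (K + 1)
    have hA' : 1 - ε / 4 ≤ A := by
      have : a n / ((K : ℝ) + 1) ≤ (l + 1) / ((K : ℝ) + 1) :=
        div_le_div_of_nonneg_right h5.le (by positivity)
      linarith [(abs_lt.1 hK2).2]
    have hB : |p n 0 * (B - Real.exp l)| ≤ ε / 4 := by
      rw [abs_mul, abs_of_nonneg (hp0 n 0)]
      exact (mul_le_of_le_one_left (abs_nonneg _) (hple n 0)).trans hK1.le
    rw [abs_lt] at h4 ⊢
    rw [abs_le] at hB
    constructor <;> nlinarith
  have h0' : Tendsto (fun n => p n 0) atTop (𝓝 (Real.exp (-l))) := by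
    have := h0.mul_const (Real.exp (-l))
    simpa [mul_assoc, ← Real.exp_add] using this
  have := (hz k).add (h0'.const_mul (l ^ k / k.factorial))
  rw [zero_add] at this
  refine (this.congr fun n => by ring).trans (le_of_eq ?_)
  congr 1
  ring

/-- Convergence of the point probabilities of random natural numbers implies convergence in
distribution. -/
lemma tendstoInDistribution_of_tendsto_singleton {Ω : ℕ → Type*} [∀ n, MeasurableSpace (Ω n)]
    (P : ∀ n, Measure (Ω n)) [∀ n, IsProbabilityMeasure (P n)] (Y : ∀ n, Ω n → ℕ)
    (hY : ∀ n, Measurable (Y n)) (μ : Measure ℕ) [IsProbabilityMeasure μ]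
    (h : ∀ k, Tendsto (fun n => (P n).real (Y n ⁻¹' {k})) atTop (𝓝 (μ.real {k}))) :
    TendstoInDistribution (fun n ω => (Y n ω : ℝ)) atTop (fun k : ℕ => (k : ℝ)) P μ := by
  have hcast : Measurable (fun k : ℕ => (k : ℝ)) := measurable_from_top
  refine ⟨fun n => (hcast.comp (hY n)).aemeasurable, hcast.aemeasurable, ?_⟩
  -- By the portmanteau theorem a lower bound on open sets suffices. It is Fatou's lemma for the
  -- counting measure applied to the point masses.
  refine tendsto_of_forall_isOpen_le_liminf' fun U hU => ?_
  simp only [ProbabilityMeasure.coe_mk]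
  have hU' : MeasurableSet U := hU.measurableSet
  set A : Set ℕ := (fun k : ℕ => (k : ℝ)) ⁻¹' U with hA
  have hsum : ∀ ν : Measure ℕ, ν A = ∫⁻ k, A.indicator (fun k => ν {k}) k ∂Measure.count := by
    intro ν
    rw [lintegral_count, Measure.tsum_indicator_apply_singleton ν A (hcast hU')]
  have h1 : ∀ n, (P n).map (fun ω => (Y n ω : ℝ)) U = ((P n).map (Y n)) A := by
    intro n
    rw [Measure.map_apply (f := fun ω => (Y n ω : ℝ)) (hcast.comp (hY n)) hU', Measure.map_apply (hY n) (hcast hU')]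
    rfl
  rw [Measure.map_apply hcast hU', hsum μ]
  simp_rw [h1, hsum]
  refine le_trans (le_of_eq ?_) (lintegral_liminf_le fun n => measurable_from_top)
  refine lintegral_congr fun k => ?_
  symm
  refine Tendsto.liminf_eq ?_
  by_cases hk : k ∈ A
  · simp only [Set.indicator_of_mem hk]
    have := ENNReal.tendsto_ofReal (h k)
    rw [ofReal_measureReal] at this
    refine this.congr fun n => ?_
    rw [ofReal_measureReal, Measure.map_apply (hY n) (measurableSet_singleton k)]
  · simp [hk]

end Poisson

/-! ### Cliques, joins and copy counts -/

section Graph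
open Finset SimpleGraph
variable {V : Type*} [Fintype V]

open scoped Classical in
/-- The vertex sets of the copies of the complete graph on `s` vertices. -/
noncomputable def cliqueSets (G : SimpleGraph V) (s : ℕ) : Finset (Finset V) := G.cliqueFinset s

lemma mem_cliqueSets {G : SimpleGraph V} {s : ℕ} {K : Finset V} :
    K ∈ cliqueSets G s ↔ G.IsNClique s K := by
  simp [cliqueSets]

open scoped Classical in
lemma card_embedding_map_univ_eq {W : Type*} [Fintype W] (K : Finset V)
    (hK : #K = Fintype.card W) :
    #{f : W ↪ V | univ.map f = K} = (Fintype.card W).factorial := by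
  have e : W ≃ K := Fintype.equivOfCardEq (by simp [hK])
  rw [← Fintype.card_equiv e, ← card_univ]
  symm
  refine card_bij (fun g _ => g.toEmbedding.trans (Function.Embedding.subtype _)) ?_ ?_ ?_
  · intro g _
    rw [mem_filter, ← Finset.map_map, map_univ_equiv]
    exact ⟨mem_univ _, attach_map_val⟩
  · intro g _ h _ hgh
    ext a
    exact congrArg (fun f : W ↪ V => f a) hgh
  · intro f hf
    have hf' : univ.map f = K := (mem_filter.1 hf).2
    have hmem : ∀ a, f a ∈ K := fun a => hf' ▸ mem_map_of_mem f (mem_univ a)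
    refine ⟨Equiv.ofBijective (fun a => ⟨f a, hmem a⟩) ⟨fun a b h => f.injective ?_, ?_⟩,
      mem_univ _, ?_⟩
    · exact congrArg Subtype.val h
    · rintro ⟨b, hb⟩
      rw [← hf', Finset.mem_map] at hb
      obtain ⟨a, -, rfl⟩ := hb
      exact ⟨a, rfl⟩
    · ext a
      rfl

open scoped Classical in
lemma prod_adj_clique (G : SimpleGraph V) (s : ℕ) (f : Fin s ↪ V) :
    (∏ e ∈ (clique s).edgeFinset, if e.map f ∈ G.edgeSet then (1 : ℝ) else 0) =
      if univ.map f ∈ cliqueSets G s then 1 else 0 := by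
  have : (univ.map f ∈ cliqueSets G s) ↔ ∀ e ∈ (clique s).edgeFinset, e.map f ∈ G.edgeSet := by
    rw [mem_cliqueSets, isNClique_iff]
    simp only [card_map, card_univ, Fintype.card_fin, and_true, mem_edgeFinset]
    constructor
    · intro h e
      induction e with
      | _ a b =>
        intro hab
        have hab : a ≠ b := by simpa using hab
        exact h (by simp) (by simp) (f.injective.ne hab)
    · intro h a ha b hb hab
      obtain ⟨i, -, rfl⟩ := mem_map.1 (mem_coe.1 ha)
      obtain ⟨j, -, rfl⟩ := mem_map.1 (mem_coe.1 hb)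
      have hij : i ≠ j := fun h => hab (by rw [h])
      exact h s(i, j) (by simpa using hij)
  split_ifs with h
  · exact prod_eq_one fun e he => if_pos (this.1 h e he)
  · rw [this] at h
    push Not at h
    obtain ⟨e, he, he'⟩ := h
    exact prod_eq_zero he (if_neg he')

/-- Each clique is the image of exactly `s!` embeddings, which cancels the `s!` automorphisms. -/
lemma monoCount_clique {C : Type*} (G : SimpleGraph V) (s : ℕ) (x : V → C) :
    monoCount (clique s) G x = monoCard (cliqueSets G s) x := by
  classical
  have haut : Nat.card (clique s ≃g clique s) = s.factorial := by
    rw [Nat.card_congr (β := Equiv.Perm (Fin s)) ⟨fun f => f.toEquiv,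
      fun f => ⟨f, by simp⟩, fun _ => rfl, fun _ => rfl⟩]
    simp [Nat.card_eq_fintype_card, Fintype.card_perm]
  have hsum : ∀ f : Fin s ↪ V,
      ((∏ e ∈ (clique s).edgeFinset, if e.map f ∈ G.edgeSet then (1 : ℝ) else 0) *
        (if ∀ a b, x (f a) = x (f b) then (1 : ℝ) else 0)) =
      if univ.map f ∈ ({K ∈ cliqueSets G s | IsMono x K} : Finset _) then 1 else 0 := by
    intro f
    have h1 := prod_adj_clique G s f
    have h2 : (∀ a b, x (f a) = x (f b)) ↔ IsMono x (univ.map f) := by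
      simp [IsMono]
    have h3 : (∏ e ∈ (clique s).edgeFinset, if e.map f ∈ G.edgeSet then (1 : ℝ) else 0) =
      if univ.map f ∈ cliqueSets G s then 1 else 0 := by convert h1
    rw [h3]
    simp only [mem_filter, h2]
    by_cases h4 : univ.map f ∈ cliqueSets G s <;> by_cases h5 : IsMono x (univ.map f) <;>
      simp [h4, h5]
  have hcount : #{f : Fin s ↪ V | univ.map f ∈ ({K ∈ cliqueSets G s | IsMono x K} : Finset _)} =
      monoCard (cliqueSets G s) x * s.factorial := by
    rw [card_eq_sum_card_fiberwise (f := fun f : Fin s ↪ V => univ.map f)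
      (t := {K ∈ cliqueSets G s | IsMono x K}), monoCard]
    · refine sum_const_nat fun K hK => ?_
      have hK' := card_embedding_map_univ_eq (W := Fin s) K
        (by simpa using (mem_cliqueSets.1 (mem_filter.1 hK).1).card_eq)
      rw [Fintype.card_fin] at hK'
      rw [← hK', filter_filter]
      congr 1
      ext f
      simp only [mem_filter_univ]
      exact ⟨fun h => h.2, fun h => ⟨h ▸ hK, h⟩⟩
    · intro f hf
      exact (mem_filter.1 hf).2
  have : ∑ f : Fin s ↪ V,
      ((∏ e ∈ (clique s).edgeFinset, if e.map f ∈ G.edgeSet then (1 : ℝ) else 0) *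
        (if ∀ a b, x (f a) = x (f b) then (1 : ℝ) else 0)) =
      monoCard (cliqueSets G s) x * s.factorial := by
    rw [sum_congr rfl fun f _ => hsum f, ← sum_filter, sum_const, hcount]
    simp
  have h0 : (s.factorial : ℝ) ≠ 0 := by positivity
  have h1 : monoCount (clique s) G x =
      1 / (s.factorial : ℝ) * (monoCard (cliqueSets G s) x * s.factorial) := by
    rw [monoCount, haut, ← this]
    congr!
  rw [h1]
  field_simp

/-- A complete subgraph is determined by its vertex set. -/
lemma copyCount_clique_le (G : SimpleGraph V) (s : ℕ) :
    G.copyCount (clique s) ≤ #(cliqueSets G s) := by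
  classical
  have hiso : ∀ H : G.Subgraph, Nonempty (clique s ≃g H.coe) →
      #(H.verts.toFinset) = s ∧ ∀ a ∈ H.verts, ∀ b ∈ H.verts, a ≠ b → H.Adj a b := by
    rintro H ⟨e⟩
    constructor
    · rw [Set.toFinset_card, ← Fintype.card_congr e.toEquiv, Fintype.card_fin]
    · intro a ha b hb hab
      have h : (clique s).Adj (e.symm ⟨a, ha⟩) (e.symm ⟨b, hb⟩) := by
        simpa using hab
      exact e.symm.map_adj_iff.1 h
  rw [copyCount]
  refine card_le_card_of_injOn (fun H => H.verts.toFinset) ?_ ?_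
  · intro H hH
    obtain ⟨h1, h2⟩ := hiso H (by simpa using hH)
    refine mem_coe.2 (mem_cliqueSets.2 ⟨fun a ha b hb hab => ?_, h1⟩)
    exact (h2 a (by simpa using ha) b (by simpa using hb) hab).adj_sub
  · intro H hH H' hH' h
    have h1 := (hiso H (by simpa using hH)).2
    have h2 := (hiso H' (by simpa using hH')).2
    have hv : H.verts = H'.verts := Set.toFinset_inj.1 h
    refine Subgraph.ext hv ?_
    ext a b
    constructor
    · intro hab
      exact h2 a (hv ▸ hab.fst_mem) b (hv ▸ hab.snd_mem) hab.ne
    · intro hab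
      exact h1 a (hv ▸ hab.fst_mem) b (hv ▸ hab.snd_mem) hab.ne

lemma copyCount_congr {W W' : Type*} {H : SimpleGraph W} {H' : SimpleGraph W'} (e : H ≃g H')
    (G : SimpleGraph V) : G.copyCount H = G.copyCount H' := by
  classical
  simp only [copyCount]
  congr 1
  ext K
  simp only [mem_filter_univ]
  exact ⟨fun ⟨f⟩ => ⟨e.symm.trans f⟩, fun ⟨f⟩ => ⟨e.trans f⟩⟩

/-- The diamond is the join of two triangles which share an edge. -/
def diamondIso : cliqueJoin 3 2 ≃g diamond where
  -- The join has shared edge `12` and non-edge `03`; the diamond has diagonal `02` and non-edge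
  -- `13`.
  toEquiv := Equiv.swap (0 : Fin 4) 1
  map_rel_iff' := by
    intro a b
    change Fin 4 at a b
    fin_cases a <;> fin_cases b <;>
      simp [cliqueJoin, diamond, edge_adj, cycleGraph_adj, Equiv.swap_apply_def] <;> decide

/-- The subgraph of `G` formed by the edges inside `K` and the edges inside `K'`. -/
def unionSubgraph (G : SimpleGraph V) (K K' : Finset V) : G.Subgraph where
  verts := {v | v ∈ K ∨ v ∈ K'}
  Adj a b := G.Adj a b ∧ ((a ∈ K ∧ b ∈ K) ∨ (a ∈ K' ∧ b ∈ K'))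
  adj_sub h := h.1
  edge_vert := by
    rintro a b ⟨hab, h | h⟩
    exacts [Or.inl h.1, Or.inr h.1]
  symm := ⟨fun _ _ h => ⟨h.1.symm, h.2.imp And.symm And.symm⟩⟩

open scoped Classical in
lemma card_union_fiber {α : Type*} (D D' : Finset α) (c : Prop × Prop) :
    Nat.card {a : {a // a ∈ D ∨ a ∈ D'} // ((a.1 ∈ D, a.1 ∈ D') : Prop × Prop) = c} =
      if c.1 then (if c.2 then #(D ∩ D') else #D - #(D ∩ D'))
        else (if c.2 then #D' - #(D ∩ D') else 0) := by
  obtain ⟨c₁, c₂⟩ := c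
  rw [Nat.card_congr (Equiv.subtypeSubtypeEquivSubtypeInter (fun a => a ∈ D ∨ a ∈ D')
    (fun a => ((a ∈ D, a ∈ D') : Prop × Prop) = (c₁, c₂)))]
  have key : ∀ (E : Finset α), (∀ a, a ∈ E ↔ (a ∈ D ∨ a ∈ D') ∧
      ((a ∈ D, a ∈ D') : Prop × Prop) = (c₁, c₂)) →
      Nat.card {a // (a ∈ D ∨ a ∈ D') ∧ ((a ∈ D, a ∈ D') : Prop × Prop) = (c₁, c₂)} = #E := by
    intro E hE
    rw [← Nat.card_eq_finsetCard E]
    exact Nat.card_congr (Equiv.subtypeEquivRight fun a => (hE a).symm)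
  by_cases h₁ : c₁ <;> by_cases h₂ : c₂ <;> simp only [h₁, h₂, if_true, if_false]
  · rw [← key (D ∩ D')] <;> simp [h₁, h₂]
    tauto
  · rw [← card_sdiff_add_card_inter D D', Nat.add_sub_cancel, ← key (D \ D')] <;> simp [h₁, h₂]
    tauto
  · rw [inter_comm, ← card_sdiff_add_card_inter D' D, Nat.add_sub_cancel, ← key (D' \ D)] <;>
      simp [h₁, h₂]
    tauto
  · rw [← card_empty (α := α), ← key ∅] <;> simp [h₁, h₂]
    tauto

open scoped Classical in
-- Two sets split their union by membership pattern, and the sizes of the pieces depend only on the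
-- three given cardinalities. Bijections between matching pieces are glued.
lemma exists_equiv_union {α β : Type*} (A A' : Finset α) (B B' : Finset β) (h : #A = #B)
    (h' : #A' = #B') (hi : #(A ∩ A') = #(B ∩ B')) :
    ∃ e : {a // a ∈ A ∨ a ∈ A'} ≃ {b // b ∈ B ∨ b ∈ B'},
      ∀ a, ((e a).1 ∈ B ↔ a.1 ∈ A) ∧ ((e a).1 ∈ B' ↔ a.1 ∈ A') := by
  have hA : Finite {a // a ∈ A ∨ a ∈ A'} :=
    Finite.of_equiv (↑(A ∪ A')) (Equiv.subtypeEquivRight fun a => by simp)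
  have hB : Finite {a // a ∈ B ∨ a ∈ B'} :=
    Finite.of_equiv (↑(B ∪ B')) (Equiv.subtypeEquivRight fun a => by simp)
  have hc : ∀ c : Prop × Prop,
      Nonempty ({a : {a // a ∈ A ∨ a ∈ A'} // ((a.1 ∈ A, a.1 ∈ A') : Prop × Prop) = c} ≃
        {b : {b // b ∈ B ∨ b ∈ B'} // ((b.1 ∈ B, b.1 ∈ B') : Prop × Prop) = c}) := by
    intro c
    rw [← Finite.card_eq, card_union_fiber, card_union_fiber, h, h', hi]
  refine ⟨Equiv.ofFiberEquiv fun c => (hc c).some, fun a => ?_⟩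
  have := Equiv.ofFiberEquiv_map (fun c => (hc c).some) a
  simp only [Prod.mk.injEq, eq_iff_iff] at this
  exact this

omit [Fintype V] in
open scoped Classical in
-- In both graphs, adjacency of distinct vertices depends only on which of the two cliques contain
-- them, so a bijection that preserves this pattern is an isomorphism.
lemma cliqueJoin_iso_unionSubgraph (G : SimpleGraph V) {s t : ℕ} (hts : t ≤ s) {K K' : Finset V}
    (hK : G.IsNClique s K) (hK' : G.IsNClique s K') (ht : #(K ∩ K') = t) :
    Nonempty (cliqueJoin s t ≃g (unionSubgraph G K K').coe) := by
  have hI : #(range s ∩ Ico (s - t) (2 * s - t)) = t := by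
    have : range s ∩ Ico (s - t) (2 * s - t) = Ico (s - t) s := by
      ext i
      simp only [mem_inter, mem_range, mem_Ico]
      omega
    rw [this, Nat.card_Ico]
    omega
  obtain ⟨e, he⟩ := exists_equiv_union (range s) (Ico (s - t) (2 * s - t)) K K'
    (by rw [card_range, hK.card_eq]) (by rw [Nat.card_Ico, hK'.card_eq]; omega)
    (by rw [ht]; convert hI)
  let f : Fin (2 * s - t) ≃ {a // a ∈ range s ∨ a ∈ Ico (s - t) (2 * s - t)} :=
    ⟨fun i => ⟨i.1, by have := i.2; simp only [mem_range, mem_Ico]; omega⟩,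
      fun a => ⟨a.1, by have := a.2; simp only [mem_range, mem_Ico] at this; omega⟩,
      fun _ => rfl, fun _ => rfl⟩
  refine ⟨⟨f.trans e, ?_⟩⟩
  intro i j
  have hi := he (f i)
  have hj := he (f j)
  have hne : (e (f i)).1 ≠ (e (f j)).1 ↔ i ≠ j := by
    rw [Ne, Ne, Subtype.val_inj, e.injective.eq_iff, f.injective.eq_iff]
  have hfi : (f i).1 = i.1 := rfl
  have hfj : (f j).1 = j.1 := rfl
  rw [hfi, mem_range, mem_Ico] at hi
  rw [hfj, mem_range, mem_Ico] at hj
  change G.Adj (e (f i)).1 (e (f j)).1 ∧ _ ↔ i ≠ j ∧ _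
  have hadj : ∀ h : ((e (f i)).1 ∈ K ∧ (e (f j)).1 ∈ K) ∨ ((e (f i)).1 ∈ K' ∧ (e (f j)).1 ∈ K'),
      G.Adj (e (f i)).1 (e (f j)).1 ↔ i ≠ j := by
    intro h
    rw [← hne]
    refine ⟨fun h => h.ne, fun hab => ?_⟩
    rcases h with h | h
    exacts [hK.isClique h.1 h.2 hab, hK'.isClique h.1 h.2 hab]
  have h2 : (((e (f i)).1 ∈ K ∧ (e (f j)).1 ∈ K) ∨ ((e (f i)).1 ∈ K' ∧ (e (f j)).1 ∈ K')) ↔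
      ((i.val < s ∧ j.val < s) ∨ (s - t ≤ i.val ∧ s - t ≤ j.val)) := by
    rw [hi.1, hi.2, hj.1, hj.2]
    simp only [i.2, j.2, and_true]
  rw [← h2]
  exact and_congr_left hadj

/-- The number of pairs of `s`-cliques with `t` common vertices is at most a constant times the
number of copies of the `t`-join. -/
lemma pairCount_cliqueSets_le (G : SimpleGraph V) {s t : ℕ} (hts : t ≤ s) :
    pairCount (cliqueSets G s) t ≤ 4 ^ (2 * s - t) * G.copyCount (cliqueJoin s t) := by
  classical
  rw [pairCount, copyCount]
  -- Each pair is sent to its union. A union has `2 * s - t` vertices and comes from two of their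
  -- subsets, so its fiber has at most `(2 * 2) ^ (2 * s - t)` elements.
  refine card_le_mul_card_image_of_maps_to (f := fun p => unionSubgraph G p.1 p.2) ?_ _ ?_
  · rintro ⟨K, K'⟩ hp
    simp only [mem_filter, mem_product, mem_cliqueSets] at hp
    simp only [mem_filter_univ]
    refine cliqueJoin_iso_unionSubgraph G hts hp.1.1 hp.1.2 ?_
    rw [← hp.2]
  · intro H hH
    obtain ⟨e⟩ := (mem_filter_univ _).1 hH
    have hcard : #(H.verts.toFinset) = 2 * s - t := by
      rw [Set.toFinset_card, ← Fintype.card_congr e.toEquiv, Fintype.card_fin]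
    calc _ ≤ #(H.verts.toFinset.powerset ×ˢ H.verts.toFinset.powerset) := by
          refine card_le_card ?_
          rintro ⟨K, K'⟩ hp
          have hH : unionSubgraph G K K' = H := (mem_filter.1 hp).2
          rw [mem_product, mem_powerset, mem_powerset, ← hH]
          constructor
          · intro a ha
            rw [Set.mem_toFinset]
            exact Or.inl ha
          · intro a ha
            rw [Set.mem_toFinset]
            exact Or.inr ha
      _ = _ := by
          rw [card_product, card_powerset, hcard, ← mul_pow]
          norm_num

end Graph

/-! ### Probabilities and means as counts of colorings -/

section Law
open Finset
variable {Ω V : Type*} [MeasurableSpace Ω] [Fintype V] {k : ℕ} {X : V → Ω → Fin k} {P : Measure Ω}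

lemma IsUniformColoring.measurable_comp (hX : IsUniformColoring X P) {β : Type*}
    [MeasurableSpace β] (f : (V → Fin k) → β) : Measurable fun ω => f fun v => X v ω :=
  (Measurable.of_discrete (f := f)).comp (measurable_pi_lambda _ hX.measurable)

open scoped Classical in
lemma IsUniformColoring.measureReal_eq (hX : IsUniformColoring X P) [IsProbabilityMeasure P]
    (Q : (V → Fin k) → Prop) :
    P.real {ω | Q fun v => X v ω} = #{x | Q x} / (k : ℝ) ^ Fintype.card V := by
  have hm : Measurable fun ω v => X v ω := measurable_pi_lambda _ hX.measurable
  have h1 : {ω | Q fun v => X v ω} =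
      (fun ω v => X v ω) ⁻¹' (({x | Q x} : Finset (V → Fin k)) : Set (V → Fin k)) := by
    ext ω
    simp
  -- Independence and uniformity make every coloring equally likely.
  have h2 : ∀ x : V → Fin k, P.real ((fun ω v => X v ω) ⁻¹' {x}) = ((k : ℝ) ^ Fintype.card V)⁻¹ := by
    intro x
    have : (fun ω v => X v ω) ⁻¹' {x} = ⋂ v ∈ (univ : Finset V), X v ⁻¹' {x v} := by
      ext ω
      simp [funext_iff]
    rw [this, measureReal_def, hX.indep.measure_inter_preimage_eq_mul univ
      (fun v _ => measurableSet_singleton _)]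
    have h3 : ∀ v, P (X v ⁻¹' {x v}) = (k : ℝ≥0∞)⁻¹ := fun v => hX.uniform v (x v)
    simp [h3]
  rw [h1, ← sum_measureReal_preimage_singleton _ fun x _ => hm (measurableSet_singleton x),
    sum_congr rfl fun x _ => h2 x, sum_const, nsmul_eq_mul, div_eq_mul_inv]

lemma IsUniformColoring.integral_monoCard (hX : IsUniformColoring X P) [IsProbabilityMeasure P]
    (hk : 1 ≤ k) (S : Finset (Finset V)) (s : ℕ) (hs : 1 ≤ s) (hS : ∀ K ∈ S, #K = s) :
    ∫ ω, (monoCard S fun v => X v ω : ℝ) ∂P = #S / (k : ℝ) ^ (s - 1) := by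
  classical
  have hk0 : (0 : ℝ) < k := by exact_mod_cast hk
  have hmeas : ∀ K : Finset V, MeasurableSet {ω | IsMono (fun v => X v ω) K} := fun K =>
    measurableSet_setOfPred.2 (hX.measurable_comp fun x => IsMono x K)
  have h1 : ∀ ω, (monoCard S fun v => X v ω : ℝ) =
      ∑ K ∈ S, {ω | IsMono (fun v => X v ω) K}.indicator (1 : Ω → ℝ) ω := by
    intro ω
    rw [monoCard, card_filter]
    push_cast
    refine sum_congr rfl fun K _ => ?_
    simp [Set.indicator_apply]
  simp_rw [h1]
  rw [integral_finsetSum (f := fun K => {ω | IsMono (fun v => X v ω) K}.indicator 1) _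
    fun K _ => (integrable_const (1 : ℝ)).indicator (hmeas K)]
  have h2 : ∀ K ∈ S, ∫ ω, {ω | IsMono (fun v => X v ω) K}.indicator (1 : Ω → ℝ) ω ∂P =
      1 / (k : ℝ) ^ (s - 1) := by
    intro K hK
    obtain ⟨u, hu⟩ : K.Nonempty := card_pos.1 (by rw [hS K hK]; omega)
    rw [integral_indicator_one (hmeas K), hX.measureReal_eq (fun x => IsMono x K)]
    have h := card_isMono (C := Fin k) K u hu
    rw [hS K hK, Fintype.card_fin] at h
    have h' : (k : ℝ) ^ (s - 1) * #{x : V → Fin k | IsMono x K} = (k : ℝ) ^ Fintype.card V := by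
      exact_mod_cast h
    rw [div_eq_div_iff (by positivity) (by positivity), ← h']
    ring
  rw [sum_congr rfl h2, sum_const, nsmul_eq_mul]
  ring

end Law

/-! ### Passage to the limit -/

section Limit
open Finset

/-- Markov's inequality at level `K + 1`; it supplies the tightness. -/
lemma one_sub_div_le_sum_measureReal {Ω : Type*} [MeasurableSpace Ω] {P : Measure Ω}
    [IsProbabilityMeasure P] {Y : Ω → ℕ} (hY : Measurable Y) (hint : Integrable (fun ω => (Y ω : ℝ)) P)
    (K : ℕ) : 1 - (∫ ω, (Y ω : ℝ) ∂P) / ((K : ℝ) + 1) ≤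
      ∑ k ∈ range (K + 1), P.real (Y ⁻¹' {k}) := by
  rw [sum_measureReal_preimage_singleton _ fun x _ => hY (measurableSet_singleton x)]
  have h1 := mul_meas_ge_le_integral_of_nonneg (μ := P) (f := fun ω => (Y ω : ℝ))
    (Eventually.of_forall fun ω => by positivity) hint ((K : ℝ) + 1)
  have h2 : {ω | (K : ℝ) + 1 ≤ (Y ω : ℝ)} = (Y ⁻¹' ↑(range (K + 1)))ᶜ := by
    ext ω
    simp only [Set.mem_ofPred_eq, Set.mem_compl_iff, Set.mem_preimage, mem_coe, mem_range, not_lt]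
    exact_mod_cast Iff.rfl
  rw [h2, probReal_compl_eq_one_sub (hY (by measurability)), mul_comm] at h1
  rw [← le_div_iff₀ (by positivity)] at h1
  linarith

variable {V : ℕ → Type*} [∀ n, Fintype (V n)] {G : ∀ n, SimpleGraph (V n)} {c : ℕ → ℕ}
    {Ω : ℕ → Type*} [∀ n, MeasurableSpace (Ω n)]
    {P : ∀ n, Measure (Ω n)} [∀ n, IsProbabilityMeasure (P n)]
    {X : ∀ n, V n → Ω n → Fin (c n)} {lam : ℝ≥0} {s : ℕ}

lemma tendsto_card_cliqueSets_div
    (hc : Tendsto c atTop atTop) (hX : ∀ n, IsUniformColoring (X n) (P n)) (hs : 2 ≤ s)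
    (hE : Tendsto (fun n => ∫ ω, monoCount (clique s) (G n) (fun v => X n v ω) ∂(P n)) atTop
      (𝓝 (lam : ℝ))) :
    Tendsto (fun n => (#(cliqueSets (G n) s) : ℝ) / (c n : ℝ) ^ (s - 1)) atTop (𝓝 (lam : ℝ)) := by
  refine hE.congr' ?_
  filter_upwards [hc.eventually_ge_atTop 1] with n hn
  simp_rw [monoCount_clique]
  exact (hX n).integral_monoCard hn _ s (by omega) fun K hK => (mem_cliqueSets.1 hK).card_eq

/-- If the clumping quantity tends to zero, the number of monochromatic cliques is asymptotically
Poisson. -/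
lemma tendstoInDistribution_of_tendsto_clumping
    (hc : Tendsto c atTop atTop) (hX : ∀ n, IsUniformColoring (X n) (P n)) (hs : 2 ≤ s)
    (hE : Tendsto (fun n => ∫ ω, monoCount (clique s) (G n) (fun v => X n v ω) ∂(P n)) atTop
      (𝓝 (lam : ℝ)))
    (hcl : Tendsto (fun n => clumping (cliqueSets (G n) s) s (c n)) atTop (𝓝 0)) :
    TendstoInDistribution (fun n ω => monoCount (clique s) (G n) (fun v => X n v ω)) atTop
      (fun k : ℕ => (k : ℝ)) P (poissonMeasure lam) := by
  classical
  simp_rw [monoCount_clique]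
  set Y : ∀ n, Ω n → ℕ := fun n ω => monoCard (cliqueSets (G n) s) fun v => X n v ω with hYdef
  have hY : ∀ n, Measurable (Y n) := fun n => (hX n).measurable_comp _
  have hint : ∀ n, Integrable (fun ω => (Y n ω : ℝ)) (P n) := by
    intro n
    refine Integrable.of_bound (C := #(cliqueSets (G n) s))
      ((measurable_from_top (f := fun k : ℕ => (k : ℝ))).comp (hY n)).aestronglyMeasurable
      (Eventually.of_forall fun ω => ?_)
    rw [Real.norm_natCast]
    exact_mod_cast card_filter_le _ _
  have ha := tendsto_card_cliqueSets_div hc hX hs hE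
  set a : ℕ → ℝ := fun n => (#(cliqueSets (G n) s) : ℝ) / (c n : ℝ) ^ (s - 1) with hadef
  have hS : ∀ n, ∀ K ∈ cliqueSets (G n) s, #K = s := fun n K hK => (mem_cliqueSets.1 hK).card_eq
  refine tendstoInDistribution_of_tendsto_singleton P Y hY (poissonMeasure lam) fun k => ?_
  rw [poissonMeasure_real_singleton]
  refine tendsto_poisson_of_stein (p := fun n k => (P n).real (Y n ⁻¹' {k})) ha
    (fun n k => measureReal_nonneg) (fun n K => ?_) (fun K => ?_) (fun j => ?_) k
  · rw [sum_measureReal_preimage_singleton _ fun x _ => hY n (measurableSet_singleton x)]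
    exact measureReal_le_one
  · filter_upwards [hc.eventually_ge_atTop 1] with n hn
    have := one_sub_div_le_sum_measureReal (hY n) (hint n) K
    rwa [(hX n).integral_monoCard hn _ s (by omega) (hS n)] at this
  · have hb : Tendsto (fun n => 2 * clumping (cliqueSets (G n) s) s (c n) + 2 * (s : ℝ) ^ 2 * a n *
        √(clumping (cliqueSets (G n) s) s (c n))) atTop (𝓝 0) := by
      have := (hcl.const_mul 2).add ((ha.const_mul (2 * (s : ℝ) ^ 2)).mul hcl.sqrt)
      simpa using this
    refine squeeze_zero_norm' ?_ hb
    filter_upwards [hc.eventually_ge_atTop 1] with n hn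
    have h := abs_stein_le (C := Fin (c n)) (cliqueSets (G n) s) s hs (hS n) (by simpa using hn) j
    simp only [Fintype.card_fin] at h
    have h1 : ∀ i, (P n).real (Y n ⁻¹' {i}) =
        #{x : V n → Fin (c n) | monoCard (cliqueSets (G n) s) x = i} /
          (c n : ℝ) ^ Fintype.card (V n) := by
      intro i
      rw [show Y n ⁻¹' {i} = {ω | monoCard (cliqueSets (G n) s) (fun v => X n v ω) = i} from rfl]
      convert (hX n).measureReal_eq fun x => monoCard (cliqueSets (G n) s) x = i
    rw [Real.norm_eq_abs, h1, h1]
    convert h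

lemma tendsto_clumping_zero
    (hc : Tendsto c atTop atTop) (hs : 2 ≤ s)
    (ha : Tendsto (fun n => (#(cliqueSets (G n) s) : ℝ) / (c n : ℝ) ^ (s - 1)) atTop
      (𝓝 (lam : ℝ)))
    (hJ : ∀ t : ℕ, 2 ≤ t → t ≤ s - 1 → (fun n => ((G n).copyCount (cliqueJoin s t) : ℝ))
      =o[atTop] (fun n => (c n : ℝ) ^ (2 * s - t - 1))) :
    Tendsto (fun n => clumping (cliqueSets (G n) s) s (c n)) atTop (𝓝 0) := by
  have hc' : Tendsto (fun n => (c n : ℝ) ^ (s - 1)) atTop atTop :=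
    (tendsto_pow_atTop (by omega)).comp (tendsto_natCast_atTop_atTop.comp hc)
  -- The diagonal term is the convergent mean divided by `c n ^ (s - 1)`, which tends to infinity
  -- since `s ≥ 2`.
  have h1 : Tendsto (fun n => (#(cliqueSets (G n) s) : ℝ) / (c n : ℝ) ^ (2 * (s - 1))) atTop
      (𝓝 0) := by
    refine (ha.div_atTop hc').congr fun n => ?_
    rw [div_div, ← pow_add, two_mul]
  have h2 : ∀ t ∈ Icc 2 (s - 1), Tendsto (fun n => (pairCount (cliqueSets (G n) s) t : ℝ) /
      (c n : ℝ) ^ (2 * s - t - 1)) atTop (𝓝 0) := by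
    intro t ht
    rw [mem_Icc] at ht
    have h3 := (hJ t ht.1 ht.2).tendsto_div_nhds_zero.const_mul ((4 : ℝ) ^ (2 * s - t))
    rw [mul_zero] at h3
    refine squeeze_zero (fun n => by positivity) (fun n => ?_) h3
    rw [← mul_div_assoc]
    refine div_le_div_of_nonneg_right ?_ (by positivity)
    exact_mod_cast pairCount_cliqueSets_le (G n) (by omega)
  simpa [clumping] using h1.add (tendsto_finsetSum (Icc 2 (s - 1)) h2)

/-- The mean converges, so the number of cliques is `O(c ^ (s - 1))`; the exponent cancels `s - 1`.
-/
lemma copyCount_clique_rpow_isBigO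
    (hc : Tendsto c atTop atTop) (hs : 2 ≤ s)
    (ha : Tendsto (fun n => (#(cliqueSets (G n) s) : ℝ) / (c n : ℝ) ^ (s - 1)) atTop
      (𝓝 (lam : ℝ)))
    {t : ℕ} (ht : t ≤ s - 1) :
    (fun n => ((G n).copyCount (clique s) : ℝ) ^
      ((2 * (s : ℝ) - (t : ℝ) - 1) / ((s : ℝ) - 1))) =O[atTop]
      (fun n => (c n : ℝ) ^ (2 * s - t - 1)) := by
  have hs1 : (0 : ℝ) < (s : ℝ) - 1 := by
    have : (2 : ℝ) ≤ s := by exact_mod_cast hs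
    linarith
  have hts : (t : ℝ) ≤ (s : ℝ) - 1 := by
    have : ((t + 1 : ℕ) : ℝ) ≤ s := by exact_mod_cast (by omega : t + 1 ≤ s)
    push_cast at this
    linarith
  set e : ℝ := (2 * (s : ℝ) - (t : ℝ) - 1) / ((s : ℝ) - 1) with he
  have he0 : 0 ≤ e := div_nonneg (by linarith) hs1.le
  refine IsBigO.of_bound (((lam : ℝ) + 1) ^ e) ?_
  filter_upwards [hc.eventually_ge_atTop 1, ha.eventually_lt_const (lt_add_one (lam : ℝ))]
    with n hn h1
  have hc0 : (0 : ℝ) < c n := by exact_mod_cast hn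
  rw [div_lt_iff₀ (by positivity)] at h1
  have h2 : ((G n).copyCount (clique s) : ℝ) ≤ ((lam : ℝ) + 1) * (c n : ℝ) ^ (s - 1) :=
    le_trans (by exact_mod_cast copyCount_clique_le (G n) s) h1.le
  rw [Real.norm_of_nonneg (by positivity), Real.norm_of_nonneg (by positivity)]
  refine (Real.rpow_le_rpow (by positivity) h2 he0).trans (le_of_eq ?_)
  rw [Real.mul_rpow (by positivity) (by positivity), ← Real.rpow_natCast, ← Real.rpow_mul hc0.le,
    ← Real.rpow_natCast _ (2 * s - t - 1)]
  congr 2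
  rw [Nat.cast_sub (by omega), Nat.cast_sub (by omega), Nat.cast_sub (by omega), he]
  push_cast
  field_simp

end Limit

end MonoClique

theorem corollary4p1
    {V : ℕ → Type*} [∀ n, Fintype (V n)] (G : ∀ n, SimpleGraph (V n))
    (c : ℕ → ℕ) (hc : Tendsto c atTop atTop)
    {Ω : ℕ → Type*} [∀ n, MeasurableSpace (Ω n)]
    (P : ∀ n, Measure (Ω n)) [∀ n, IsProbabilityMeasure (P n)]
    (X : ∀ n, V n → Ω n → Fin (c n)) (hX : ∀ n, MonoClique.IsUniformColoring (X n) (P n))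
    (lam : ℝ≥0) :
    (∀ s : ℕ, 2 ≤ s →
      Tendsto (fun n => ∫ ω, MonoClique.monoCount (MonoClique.clique s) (G n)
        (fun v => X n v ω) ∂(P n)) atTop (𝓝 (lam : ℝ)) →
      (∀ t : ℕ, 2 ≤ t → t ≤ s - 1 →
        (fun n => ((G n).copyCount (MonoClique.cliqueJoin s t) : ℝ))
          =o[atTop] (fun n => (c n : ℝ) ^ (2 * s - t - 1))) →
      TendstoInDistribution (fun n ω => MonoClique.monoCount (MonoClique.clique s) (G n)
        (fun v => X n v ω)) atTop (fun k : ℕ => (k : ℝ)) P (poissonMeasure lam)) ∧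
    (∀ s : ℕ, 2 ≤ s →
      Tendsto (fun n => ∫ ω, MonoClique.monoCount (MonoClique.clique s) (G n)
        (fun v => X n v ω) ∂(P n)) atTop (𝓝 (lam : ℝ)) →
      (∀ t : ℕ, 2 ≤ t → t ≤ s - 1 →
        (fun n => ((G n).copyCount (MonoClique.cliqueJoin s t) : ℝ))
          =o[atTop] (fun n => ((G n).copyCount (MonoClique.clique s) : ℝ) ^
            ((2 * (s : ℝ) - (t : ℝ) - 1) / ((s : ℝ) - 1)))) →
      TendstoInDistribution (fun n ω => MonoClique.monoCount (MonoClique.clique s) (G n)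
        (fun v => X n v ω)) atTop (fun k : ℕ => (k : ℝ)) P (poissonMeasure lam)) ∧
    (Tendsto (fun n => ∫ ω, MonoClique.monoCount (MonoClique.clique 3) (G n)
        (fun v => X n v ω) ∂(P n)) atTop (𝓝 (lam : ℝ)) →
      (fun n => ((G n).copyCount MonoClique.diamond : ℝ))
        =o[atTop] (fun n => ((G n).copyCount (MonoClique.clique 3) : ℝ) ^ (3 / 2 : ℝ)) →
      TendstoInDistribution (fun n ω => MonoClique.monoCount (MonoClique.clique 3) (G n)
        (fun v => X n v ω)) atTop (fun k : ℕ => (k : ℝ)) P (poissonMeasure lam)) := by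
  have hJ : ∀ s : ℕ, 2 ≤ s →
      Tendsto (fun n => ∫ ω, MonoClique.monoCount (MonoClique.clique s) (G n)
        (fun v => X n v ω) ∂(P n)) atTop (𝓝 (lam : ℝ)) →
      (∀ t : ℕ, 2 ≤ t → t ≤ s - 1 →
        (fun n => ((G n).copyCount (MonoClique.cliqueJoin s t) : ℝ))
          =o[atTop] (fun n => (c n : ℝ) ^ (2 * s - t - 1))) →
      TendstoInDistribution (fun n ω => MonoClique.monoCount (MonoClique.clique s) (G n)
        (fun v => X n v ω)) atTop (fun k : ℕ => (k : ℝ)) P (poissonMeasure lam) :=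
    fun s hs hE h => MonoClique.tendstoInDistribution_of_tendsto_clumping hc hX hs hE
      (MonoClique.tendsto_clumping_zero hc hs
        (MonoClique.tendsto_card_cliqueSets_div hc hX hs hE) h)
  have hN : ∀ s : ℕ, 2 ≤ s →
      Tendsto (fun n => ∫ ω, MonoClique.monoCount (MonoClique.clique s) (G n)
        (fun v => X n v ω) ∂(P n)) atTop (𝓝 (lam : ℝ)) →
      (∀ t : ℕ, 2 ≤ t → t ≤ s - 1 →
        (fun n => ((G n).copyCount (MonoClique.cliqueJoin s t) : ℝ))
          =o[atTop] (fun n => ((G n).copyCount (MonoClique.clique s) : ℝ) ^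
            ((2 * (s : ℝ) - (t : ℝ) - 1) / ((s : ℝ) - 1)))) →
      TendstoInDistribution (fun n ω => MonoClique.monoCount (MonoClique.clique s) (G n)
        (fun v => X n v ω)) atTop (fun k : ℕ => (k : ℝ)) P (poissonMeasure lam) :=
    fun s hs hE h => hJ s hs hE fun t h2 ht => (h t h2 ht).trans_isBigO
      (MonoClique.copyCount_clique_rpow_isBigO hc hs
        (MonoClique.tendsto_card_cliqueSets_div hc hX hs hE) ht)
  refine ⟨hJ, hN, fun hE h => hN 3 (by norm_num) hE fun t h2 ht => ?_⟩
  -- For `s = 3` the only join is the diamond, and the exponent is `(6 - 2 - 1) / 2 = 3 / 2`.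
  obtain rfl : t = 2 := by omega
  refine (h.congr (fun n => ?_) fun n => ?_)
  · rw [MonoClique.copyCount_congr MonoClique.diamondIso]
  · norm_num
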